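/- Let $H$ be a finite set with $N=|H|$ elements, let $1\le k\le N$, and let $A$ be an $N$-dimensional quantum system with orthonormal basis $\{|\eta\rangle\}_{\eta\in H}$. Let $\Xi$ be the set of all $k$-element subsets of $H$. For $\xi\in\Xi$ let $\mathcal O^\xi$ be the channel $\rho\mapsto O^\xi\rho\,O^{\xi\dagger}$ on $A$, where $O^\xi=I-2\sum_{u\in\xi}|u\rangle\langle u|$. An algorithm with $n$ queries and a finite-dimensional working system $R$ consists of quantum channels (completely positive trace-preserving maps) $\Phi^1,\dots,\Phi^n$ on $AR$ and a POVM $\{M^\eta\}_{\eta\in H}$ on $AR$. If the oracle is $\xi$, it starts in a fixed computational basis state $|0\rangle\langle0|_{AR}$, applies $\Phi^1$, $\mathcal O^\xi\otimes\mathrm{id}_R$, $\Phi^2$, $\mathcal O^\xi\otimes\mathrm{id}_R$, $\dots$, $\Phi^n$, $\mathcal O^\xi\otimes\mathrm{id}_R$, reaching a state $\rho^\xi$, and then measures $\{M^\eta\}$. An answer $\eta$ is correct if and only if $\eta\in\xi$. The error probability of the algorithm for the uniform prior on $\Xi$ is $$\frac1{|\Xi|}\sum_{\xi\in\Xi}\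 \sum_{\eta\in H\setminus\xi}\mathrm{Tr}\left(M^\eta\rho^\xi\right),$$ and $p_{\mathrm{err}}(n)$ is its minimum over all algorithms with $n$ queries and working system $R$ (of any fixed dimension $\dim R\ge1$). Let $n\ge0$ and suppose that $(2n+1)\arcsin\sqrt{k/N}\le\pi/2$. Then every algorithm with $n$ queries has error probability at least $$\cos^2\left((2n+1)\arcsin\sqrt{k/N}\right).$$ Moreover, Grover's algorithm with $n$ queries attains this value: it prepares $|s\rangle=N^{-1/2}\sum_{\eta\in H}|\eta\rangle$ in $A$ by any unitary that maps the initial basis state of $A$ to $|s\rangle$, then $n$ times applies the oracle followed by $2|s\rangle\langle s|-I$, and finally measures $A$ in the computational basis. Hence Grover's algorithm is exactly optimal, and $$p_{\mathrm{err}}(n)=\cos^2\left((2n+1)\arcsin\sqrt{k/N}\right).$$ -/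

import Mathlib

open scoped Matrix Kronecker ComplexOrder

noncomputable section

namespace QChan

/-- `Φ ⊗ id_Z`, for a linear map `Φ : L(X) → L(Y)` between operator spaces: `Φ` acts on the first
tensor factor and the second one is left alone. A system is given by the index type of its
computational basis, and the system `XZ` has the basis `X × Z`. -/
def ampliate {X Y : Type*} (Z : Type*)
    (Φ : Matrix X X ℂ →ₗ[ℂ] Matrix Y Y ℂ) :
    Matrix (X × Z) (X × Z) ℂ →ₗ[ℂ] Matrix (Y × Z) (Y × Z) ℂ where
  toFun M := Matrix.of fun p q => Φ (Matrix.of fun i j => M (i, p.2) (j, q.2)) p.1 q.1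
  map_add' M N := by
    ext p q
    exact congrFun (congrFun (Φ.map_add (Matrix.of fun i j => M (i, p.2) (j, q.2))
      (Matrix.of fun i j => N (i, p.2) (j, q.2))) p.1) q.1
  map_smul' c M := by
    ext p q
    exact congrFun (congrFun (Φ.map_smul c
      (Matrix.of fun i j => M (i, p.2) (j, q.2))) p.1) q.1

/-- Quantum channels from the system `X` to the system `Y`: completely positive and trace
preserving linear maps. -/
structure Channel (X Y : Type*) [Fintype X] [Fintype Y] where
  /-- the underlying linear map -/
  toLin : Matrix X X ℂ →ₗ[ℂ] Matrix Y Y ℂ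
  completelyPositive : ∀ (d : ℕ) (M : Matrix (X × Fin d) (X × Fin d) ℂ),
    M.PosSemidef → (ampliate (Fin d) toLin M).PosSemidef
  tracePreserving : ∀ M : Matrix X X ℂ, (toLin M).trace = M.trace

/-- Conjugation `M ↦ V M V†` as a linear map. -/
def conjLin {X Y : Type*} [Fintype X] (V : Matrix Y X ℂ) :
    Matrix X X ℂ →ₗ[ℂ] Matrix Y Y ℂ where
  toFun M := V * M * Vᴴ
  map_add' M N := by rw [Matrix.mul_add, Matrix.add_mul]
  map_smul' c M := by simp

theorem ampliate_conjLin {X Y Z : Type*} [Fintype X] [Fintype Z] [DecidableEq Z]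
    (V : Matrix Y X ℂ) (M : Matrix (X × Z) (X × Z) ℂ) :
    ampliate Z (conjLin V) M
      = (V ⊗ₖ (1 : Matrix Z Z ℂ)) * M * (V ⊗ₖ (1 : Matrix Z Z ℂ))ᴴ := by
  ext p q
  simp [ampliate, conjLin, Matrix.mul_apply, Fintype.sum_prod_type, Matrix.one_apply,
    apply_ite (starRingEnd ℂ)]

/-- The channel `ρ ↦ V ρ V†` of an isometry (in particular, of a unitary operator) `V`. -/
def Channel.ofIsometry {X Y : Type*} [Fintype X] [Fintype Y] [DecidableEq X]
    (V : Matrix Y X ℂ) (hV : Vᴴ * V = 1) : Channel X Y where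
  toLin := conjLin V
  completelyPositive d M hM := by
    rw [ampliate_conjLin]
    exact hM.mul_mul_conjTranspose_same _
  tracePreserving M := by
    change (V * M * Vᴴ).trace = M.trace
    rw [Matrix.trace_mul_comm, ← Matrix.mul_assoc, hV, Matrix.one_mul]

/-- Positive operator-valued measures on the system `X` with outcomes in `H`. -/
structure POVM (X H : Type*) [Fintype X] [DecidableEq X] [Fintype H] where
  /-- the measurement operators -/
  op : H → Matrix X X ℂ
  posSemidef : ∀ η, (op η).PosSemidef
  sum_eq_one : ∑ η, op η = 1

/-- A quantum channel group discrimination problem: a finite family of channels `A → B`, a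
probability distribution on it, and a family of sets `C η` of indices; if the channel given as an
oracle is `oracle ξ`, the correct answers are the `η` such that `ξ ∈ C η`. -/
structure GroupDiscriminationProblem (Ξ A B H : Type*) [Fintype Ξ] [Fintype A] [Fintype B] where
  /-- the channels -/
  oracle : Ξ → Channel A B
  /-- the prior probabilities -/
  prior : Ξ → ℝ
  prior_nonneg : ∀ ξ, 0 ≤ prior ξ
  prior_sum : ∑ ξ, prior ξ = 1
  /-- the groups of channels -/
  C : H → Set Ξ

/-- A discrimination algorithm with `n` queries and working system `R`: the channels
`BR → AR` applied before each of the queries, and the final measurement. -/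
structure DiscriminationAlgorithm (A B R H : Type*) [Fintype A] [Fintype B] [Fintype R] [Fintype H]
    [DecidableEq B] [DecidableEq R] (n : ℕ) where
  /-- `step j` is applied just before query number `j + 1` -/
  step : Fin n → Channel (B × R) (A × R)
  /-- the final measurement -/
  measurement : POVM (B × R) H

namespace DiscriminationAlgorithm

variable {Ξ A B R H : Type*} [Fintype Ξ] [Fintype A] [Fintype B] [Fintype R] [Fintype H]
    [DecidableEq B] [DecidableEq R] {n : ℕ}

/-- The state `(O ⊗ id_R) ∘ Φⁿ ∘ ⋯ ∘ (O ⊗ id_R) ∘ Φ¹ (|z⟩⟨z|)` before the measurement, where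
`|z⟩` is the basis vector of `BR` in which the computation starts. -/
def finalState (alg : DiscriminationAlgorithm A B R H n) (O : Channel A B) (z : B × R) :
    Matrix (B × R) (B × R) ℂ :=
  Fin.foldl n (fun ρ j => ampliate R O.toLin ((alg.step j).toLin ρ)) (Matrix.single z z 1)

open Classical in
/-- The error probability of an algorithm. (The traces are real, so that `re` only changes
their type.) -/
def errorProb (alg : DiscriminationAlgorithm A B R H n)
    (P : GroupDiscriminationProblem Ξ A B H) (z : B × R) : ℝ :=
  ∑ ξ, P.prior ξ * ∑ η with ξ ∉ P.C η,
    ((alg.measurement.op η * alg.finalState (P.oracle ξ) z).trace).re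

end DiscriminationAlgorithm

/-- The minimum error probability `p_err(n)` over all algorithms with `n` queries, working system
`R` and initial state `|z⟩`. -/
def minErrorProb {Ξ A B R H : Type*} [Fintype Ξ] [Fintype A] [Fintype B] [Fintype R] [Fintype H]
    [DecidableEq B] [DecidableEq R] (P : GroupDiscriminationProblem Ξ A B H) (z : B × R)
    (n : ℕ) : ℝ :=
  sInf (Set.range fun alg : DiscriminationAlgorithm A B R H n => alg.errorProb P z)

section Grover

variable {H : Type*} [Fintype H] [DecidableEq H]

/-- The reflection `I - 2 ∑_{u ∈ ξ} |u⟩⟨u|`. -/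
def reflection (ξ : Finset H) : Matrix H H ℂ :=
  1 - (2 : ℂ) • ∑ u ∈ ξ, Matrix.single u u (1 : ℂ)

theorem reflection_eq_diagonal (ξ : Finset H) :
    reflection ξ = Matrix.diagonal fun u => if u ∈ ξ then (-1 : ℂ) else 1 := by
  have h : ∑ u ∈ ξ, Matrix.single u u (1 : ℂ)
      = Matrix.diagonal fun u => if u ∈ ξ then (1 : ℂ) else 0 := by
    ext i j
    rw [Matrix.sum_apply]
    by_cases hij : i = j
    · subst hij
      simp [Matrix.single_apply]
    · rw [Matrix.diagonal_apply_ne _ hij]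
      refine Finset.sum_eq_zero fun u _ => ?_
      rw [Matrix.single_apply, if_neg]
      rintro ⟨rfl, rfl⟩
      exact hij rfl
  rw [reflection, h]
  ext i j
  by_cases hij : i = j
  · subst hij
    by_cases hi : i ∈ ξ <;> simp [hi]
    norm_num
  · simp [hij]

theorem reflection_isometry (ξ : Finset H) : (reflection ξ)ᴴ * reflection ξ = 1 := by
  rw [reflection_eq_diagonal, Matrix.diagonal_conjTranspose, Matrix.diagonal_mul_diagonal,
    ← Matrix.diagonal_one]
  congr 1
  ext u
  by_cases hu : u ∈ ξ <;> simp [hu]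

/-- Unstructured search with exactly `k` marked elements: the oracle is the reflection of an
unknown `k`-element subset `ξ` of `H`, all of which are equally likely, and the correct answers are
the elements of `ξ`. -/
def searchProblem (H : Type*) [Fintype H] [DecidableEq H] (k : ℕ) (hk : k ≤ Fintype.card H) :
    GroupDiscriminationProblem {ξ : Finset H // ξ.card = k} H H H where
  oracle ξ := Channel.ofIsometry (reflection ξ.1) (reflection_isometry ξ.1)
  prior _ := 1 / (Fintype.card {ξ : Finset H // ξ.card = k} : ℝ)
  prior_nonneg _ := by positivity
  prior_sum := by
    have h : (Fintype.card {ξ : Finset H // ξ.card = k} : ℝ) ≠ 0 := by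
      rw [Fintype.card_finset_len]
      exact_mod_cast (Nat.choose_pos hk).ne'
    rw [Finset.sum_const, Finset.card_univ, nsmul_eq_mul, mul_one_div_cancel h]
  C η := {ξ | η ∈ ξ.1}

/-- The uniform superposition `|s⟩ = |H|^{-1/2} ∑_η |η⟩`. -/
def uniformState (H : Type*) [Fintype H] : H → ℂ :=
  fun _ => ((1 / √(Fintype.card H : ℝ) : ℝ) : ℂ)

/-- Grover's diffusion operator `2 |s⟩⟨s| - I`. -/
def diffusion (H : Type*) [Fintype H] [DecidableEq H] : Matrix H H ℂ :=
  (2 : ℂ) • Matrix.vecMulVec (uniformState H) (star (uniformState H)) - 1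

theorem diffusion_isometry : (diffusion H)ᴴ * diffusion H = 1 := by
  rcases isEmpty_or_nonempty H with hH | hH
  · exact Subsingleton.elim _ _
  have hs : star (uniformState H) ⬝ᵥ uniformState H = 1 := by
    have h : (0 : ℝ) < Fintype.card H := by exact_mod_cast Fintype.card_pos
    have h2 : ((√(Fintype.card H : ℝ) : ℝ) : ℂ) * ((√(Fintype.card H : ℝ) : ℝ) : ℂ)
        = (Fintype.card H : ℂ) := by
      rw [← Complex.ofReal_mul, Real.mul_self_sqrt h.le, Complex.ofReal_natCast]
    have h3 : (Fintype.card H : ℂ) ≠ 0 := by exact_mod_cast h.ne'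
    simp only [dotProduct, uniformState, Pi.star_apply, Finset.sum_const, Finset.card_univ,
      nsmul_eq_mul, RCLike.star_def, Complex.conj_ofReal]
    rw [one_div, Complex.ofReal_inv, ← mul_inv, h2, mul_inv_cancel₀ h3]
  have hp : Matrix.vecMulVec (uniformState H) (star (uniformState H))
      * Matrix.vecMulVec (uniformState H) (star (uniformState H))
      = Matrix.vecMulVec (uniformState H) (star (uniformState H)) := by
    rw [Matrix.vecMulVec_mul_vecMulVec, hs, one_smul]
  have hh : (diffusion H)ᴴ = diffusion H := by
    simp [diffusion, Matrix.conjTranspose_sub, Matrix.conjTranspose_smul,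
      Matrix.conjTranspose_vecMulVec]
  rw [hh, diffusion]
  simp only [Matrix.sub_mul, Matrix.mul_sub, Matrix.smul_mul, Matrix.mul_smul, hp, Matrix.one_mul,
    Matrix.mul_one]
  module

/-- The `j`-th gate of Grover's algorithm between the queries: first the unitary `F` that prepares
the uniform superposition, then always the diffusion operator. -/
def groverGate (F : Matrix.unitaryGroup H ℂ) : ℕ → Matrix H H ℂ
  | 0 => F.1
  | _ + 1 => diffusion H

theorem groverGate_isometry (F : Matrix.unitaryGroup H ℂ) (j : ℕ) :
    (groverGate F j)ᴴ * groverGate F j = 1 := by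
  cases j with
  | zero => exact Unitary.star_mul_self_of_mem F.2
  | succ j => exact diffusion_isometry

theorem kronecker_isometry (R : Type*) [Fintype R] [DecidableEq R] {V : Matrix H H ℂ}
    (hV : Vᴴ * V = 1) :
    (V ⊗ₖ (1 : Matrix R R ℂ))ᴴ * (V ⊗ₖ (1 : Matrix R R ℂ)) = 1 := by
  rw [Matrix.conjTranspose_kronecker, ← Matrix.mul_kronecker_mul, hV]
  simp

theorem sum_single : ∑ η : H, Matrix.single η η (1 : ℂ) = 1 := by
  ext i j
  rw [Matrix.sum_apply]
  by_cases hij : i = j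
  · subst hij
    simp [Matrix.single_apply]
  · rw [Matrix.one_apply_ne hij]
    refine Finset.sum_eq_zero fun u _ => ?_
    rw [Matrix.single_apply, if_neg]
    rintro ⟨rfl, rfl⟩
    exact hij rfl

/-- The measurement that applies the operator `V` to the first factor and then measures this factor
in the computational basis: `M^η = V†|η⟩⟨η|V ⊗ I`. -/
def measureAfter (R : Type*) [Fintype R] [DecidableEq R] (V : Matrix H H ℂ) (hV : Vᴴ * V = 1) :
    POVM (H × R) H where
  op η := (Vᴴ * Matrix.single η η 1 * V) ⊗ₖ (1 : Matrix R R ℂ)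
  posSemidef η := by
    have h : (Matrix.single η η (1 : ℂ)).PosSemidef := by
      rw [← Matrix.diagonal_single]
      exact Matrix.PosSemidef.diagonal (Pi.single_nonneg.2 zero_le_one)
    exact (h.conjTranspose_mul_mul_same V).kronecker Matrix.PosSemidef.one
  sum_eq_one := by
    have h : ∑ η : H, Vᴴ * Matrix.single η η (1 : ℂ) * V = 1 := by
      rw [← Finset.sum_mul, ← Finset.mul_sum, sum_single, Matrix.mul_one, hV]
    have h2 : ∑ η : H, (Vᴴ * Matrix.single η η (1 : ℂ) * V) ⊗ₖ (1 : Matrix R R ℂ)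
        = (∑ η : H, Vᴴ * Matrix.single η η (1 : ℂ) * V) ⊗ₖ (1 : Matrix R R ℂ) := by
      ext p q
      simp [Matrix.sum_apply, Matrix.kroneckerMap_apply, Finset.sum_mul]
    rw [h2, h, Matrix.one_kronecker_one]

/-- Grover's algorithm with `n` queries: prepare the uniform superposition with `F`, repeat `n`
times the query followed by the diffusion operator, and measure in the computational basis. The
working system is left alone, and the last gate is part of the measurement. -/
def groverAlgorithm (R : Type*) [Fintype R] [DecidableEq R] (F : Matrix.unitaryGroup H ℂ)
    (n : ℕ) : DiscriminationAlgorithm H H R H n where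
  step j := Channel.ofIsometry (groverGate F j ⊗ₖ (1 : Matrix R R ℂ))
    (kronecker_isometry R (groverGate_isometry F j))
  measurement := measureAfter R (groverGate F n) (groverGate_isometry F n)

end Grover

end QChan

end

/-!
The lower bound is a triangle inequality for angles. Let the oracle be prepared in the uniform
superposition `|u⟩ = |Ξ|^{-1/2} ∑_ξ |ξ⟩` of all `k`-element sets, in an additional system that
controls the queries. This turns a run of the algorithm into a single joint state `σ` whose block
`⟨ξ|σ|ξ⟩` is `|Ξ|⁻¹` times the state `ρ^ξ` (`exists_jointState`). Call the angle `φ` with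
`cos² φ = Tr ((I ⊗ |u⟩⟨u|) σ)` the angle between `σ` and `u`, and put `θ = arcsin √(k/N)`.

* The channels of the algorithm act on the other factor and do not change this angle.
* If the element `a` is queried, then the oracle system undergoes a reflection that takes `u` to a
  vector at the angle `2θ` from `u`, whatever `a` is. So `φ` grows by at most `2θ`, and after `n`
  queries it is at most `2nθ`.
* If the answer is `η`, then the probability of an error is at least the weight of the uniform
  superposition of the `ξ` that do not contain `η`. This vector is at the angle `θ` from `u`,
  whatever `η` is, so that the total weight is at least `cos² (2nθ + θ)`.

The last two steps are the same inequality, `cos_sq_add_le_sum_posSemidef`. It is applied to the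
positive semidefinite matrices `Tr_{AR} ((M^i ⊗ I) σ)` that a POVM on `AR` produces on the oracle
system: for a query the POVM is the measurement of the query register in the computational basis,
since the controlled query is diagonal in it, and at the end it is the POVM of the algorithm. As the
inequality is about density matrices, algorithms with general channels need not be purified.

In Grover's algorithm each query followed by the diffusion operator rotates the plane spanned by the
uniform superpositions of the marked and of the unmarked elements by `2θ`
(`diffusion_reflection_groverPlane`), so that the bound is attained.
-/

namespace QChan

open Matrix

/-! ### The triangle inequality for angles -/

section Angle

variable {ι I Z : Type*} [Fintype ι] [Fintype I] [Fintype Z]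

theorem sq_dotProduct_le (x y : Z → ℝ) : (x ⬝ᵥ y) ^ 2 ≤ (x ⬝ᵥ x) * (y ⬝ᵥ y) := by
  simpa [dotProduct, pow_two] using Finset.sum_mul_sq_le_sq_mul_sq Finset.univ x y

/-- If the component of `x` along `u` is removed, what is left is seen by a unit vector `v` at angle
`α` from `u` only through the part `v - cos α • u` of length `sin α`. -/
theorem sq_dotProduct_sub_le {u v : Z → ℝ} {α : ℝ} (hu : u ⬝ᵥ u = 1) (hv : v ⬝ᵥ v = 1)
    (huv : u ⬝ᵥ v = Real.cos α) (x : Z → ℝ) :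
    (v ⬝ᵥ x - Real.cos α * (u ⬝ᵥ x)) ^ 2 ≤ Real.sin α ^ 2 * (x ⬝ᵥ x - (u ⬝ᵥ x) ^ 2) := by
  have h := sq_dotProduct_le (v - Real.cos α • u) (x - (u ⬝ᵥ x) • u)
  have hvu : v ⬝ᵥ u = Real.cos α := by rw [dotProduct_comm, huv]
  have hxu : x ⬝ᵥ u = u ⬝ᵥ x := dotProduct_comm _ _
  simp only [sub_dotProduct, dotProduct_sub, smul_dotProduct, dotProduct_smul, smul_eq_mul,
    hu, hv, huv, hvu, hxu] at h
  rw [Real.sin_sq]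
  linarith

theorem sqrt_sum_sq_le_add (a b : ι → ℝ) :
    √(∑ i, a i ^ 2) ≤ √(∑ i, b i ^ 2) + √(∑ i, (b i - a i) ^ 2) := by
  have h := norm_le_norm_add_norm_sub (WithLp.toLp 2 b : EuclideanSpace ℝ ι) (WithLp.toLp 2 a)
  simpa [EuclideanSpace.norm_eq] using h

/-- Triangle inequality for angles, for a family `x` of vectors of total squared length one: if the
angle between the family and the constant family `u` is at most `φ`, and each `v i` is at the angle
`α` from `u`, then the angle between `x` and `v` is at most `φ + α`. -/
theorem cos_sq_add_le_sum_sq {x v : ι → Z → ℝ} {u : Z → ℝ} {φ α : ℝ} (hφ : 0 ≤ φ) (hα : 0 ≤ α)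
    (hφα : φ + α ≤ Real.pi / 2) (hu : u ⬝ᵥ u = 1) (hv : ∀ i, v i ⬝ᵥ v i = 1)
    (huv : ∀ i, u ⬝ᵥ v i = Real.cos α) (hx : ∑ i, x i ⬝ᵥ x i = 1)
    (hw : Real.cos φ ^ 2 ≤ ∑ i, (u ⬝ᵥ x i) ^ 2) :
    Real.cos (φ + α) ^ 2 ≤ ∑ i, (v i ⬝ᵥ x i) ^ 2 := by
  have hpi := Real.pi_pos
  have hcφ : 0 ≤ Real.cos φ := Real.cos_nonneg_of_mem_Icc ⟨by linarith, by linarith⟩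
  have hcα : 0 ≤ Real.cos α := Real.cos_nonneg_of_mem_Icc ⟨by linarith, by linarith⟩
  have hsφ : 0 ≤ Real.sin φ := Real.sin_nonneg_of_nonneg_of_le_pi hφ (by linarith)
  have hsα : 0 ≤ Real.sin α := Real.sin_nonneg_of_nonneg_of_le_pi hα (by linarith)
  have hc : 0 ≤ Real.cos (φ + α) := Real.cos_nonneg_of_mem_Icc ⟨by linarith, hφα⟩
  have hA : Real.cos α * Real.cos φ ≤ √(∑ i, (Real.cos α * (u ⬝ᵥ x i)) ^ 2) := by
    apply Real.le_sqrt_of_sq_le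
    simp_rw [mul_pow]
    rw [← Finset.mul_sum]
    gcongr
  have hD : √(∑ i, (v i ⬝ᵥ x i - Real.cos α * (u ⬝ᵥ x i)) ^ 2)
      ≤ Real.sin α * Real.sin φ := by
    apply Real.sqrt_le_iff.2 ⟨by positivity, _⟩
    calc ∑ i, (v i ⬝ᵥ x i - Real.cos α * (u ⬝ᵥ x i)) ^ 2
        ≤ ∑ i, Real.sin α ^ 2 * (x i ⬝ᵥ x i - (u ⬝ᵥ x i) ^ 2) :=
          Finset.sum_le_sum fun i _ => sq_dotProduct_sub_le hu (hv i) (huv i) (x i)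
      _ = Real.sin α ^ 2 * (1 - ∑ i, (u ⬝ᵥ x i) ^ 2) := by
          rw [← Finset.mul_sum, Finset.sum_sub_distrib, hx]
      _ ≤ Real.sin α ^ 2 * Real.sin φ ^ 2 := by
          rw [Real.sin_sq φ]
          gcongr
      _ = (Real.sin α * Real.sin φ) ^ 2 := by ring
  have h := sqrt_sum_sq_le_add (fun i => Real.cos α * (u ⬝ᵥ x i)) (fun i => v i ⬝ᵥ x i)
  rw [← Real.le_sqrt hc (Finset.sum_nonneg fun i _ => sq_nonneg _), Real.cos_add]
  linarith

/-- A positive semidefinite real matrix is the Gram matrix of the columns of some matrix, so that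
its quadratic form is a sum of squares. -/
theorem exists_rows_of_posSemidef {A : Matrix Z Z ℝ} (hA : A.PosSemidef) :
    ∃ x : Z → Z → ℝ, (∀ w, w ⬝ᵥ A *ᵥ w = ∑ j, (w ⬝ᵥ x j) ^ 2) ∧
      ∀ ξ, A ξ ξ = ∑ j, x j ξ ^ 2 := by
  classical
  open scoped MatrixOrder in
  obtain ⟨B, rfl⟩ := CStarAlgebra.nonneg_iff_eq_star_mul_self.mp hA.nonneg
  refine ⟨B, fun w => ?_, fun ξ => ?_⟩
  · rw [star_eq_conjTranspose, conjTranspose_eq_transpose_of_trivial, ← mulVec_mulVec,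
      dotProduct_mulVec, vecMul_transpose]
    simp only [dotProduct, mulVec, pow_two, mul_comm]
  · rw [star_eq_conjTranspose, conjTranspose_eq_transpose_of_trivial]
    simp [mul_apply, pow_two]

/-- The triangle inequality for angles, for the quadratic forms of a family `A` of positive
semidefinite matrices of total trace one: it is `cos_sq_add_le_sum_sq` for the rows that give them. -/
theorem cos_sq_add_le_sum_posSemidef {A : I → Matrix Z Z ℝ} (hA : ∀ i, (A i).PosSemidef)
    (htr : ∑ i, (A i).trace = 1) {u : Z → ℝ} {v : I → Z → ℝ} {φ α : ℝ} (hφ : 0 ≤ φ) (hα : 0 ≤ α)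
    (hφα : φ + α ≤ Real.pi / 2) (hu : u ⬝ᵥ u = 1) (hv : ∀ i, v i ⬝ᵥ v i = 1)
    (huv : ∀ i, u ⬝ᵥ v i = Real.cos α) (hw : Real.cos φ ^ 2 ≤ ∑ i, u ⬝ᵥ A i *ᵥ u) :
    Real.cos (φ + α) ^ 2 ≤ ∑ i, v i ⬝ᵥ A i *ᵥ v i := by
  choose x hx hx' using fun i => exists_rows_of_posSemidef (hA i)
  simp_rw [hx] at hw ⊢
  rw [← Fintype.sum_prod_type'] at hw ⊢
  refine cos_sq_add_le_sum_sq (x := fun p : I × Z => x p.1 p.2) (v := fun p => v p.1) hφ hα hφα hu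
    (fun p => hv p.1) (fun p => huv p.1) ?_ hw
  rw [← htr, Fintype.sum_prod_type]
  refine Finset.sum_congr rfl fun i _ => ?_
  simp only [trace, diag_apply, hx', dotProduct, ← pow_two]
  exact Finset.sum_comm

/-- The part of the trace on a set `s` bounds the quadratic form at a unit vector supported
on `s`. -/
theorem dotProduct_mulVec_le_sum_diag {A : Matrix Z Z ℝ} (hA : A.PosSemidef) {b : Z → ℝ}
    (hb : b ⬝ᵥ b = 1) (s : Finset Z) (hs : ∀ ξ ∉ s, b ξ = 0) :
    b ⬝ᵥ A *ᵥ b ≤ ∑ ξ ∈ s, A ξ ξ := by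
  obtain ⟨x, hx, hx'⟩ := exists_rows_of_posSemidef hA
  rw [hx]
  simp_rw [hx']
  rw [Finset.sum_comm]
  refine Finset.sum_le_sum fun j _ => ?_
  have h1 : ∀ y : Z → ℝ, ∑ ξ ∈ s, b ξ * y ξ = b ⬝ᵥ y := fun y =>
    Finset.sum_subset s.subset_univ fun ξ _ hξ => by rw [hs ξ hξ, zero_mul]
  have h := Finset.sum_mul_sq_le_sq_mul_sq s b (x j)
  simp_rw [pow_two (b _)] at h
  rwa [h1, h1, hb, one_mul] at h

/-- The real part of a positive semidefinite matrix has the same quadratic form at real vectors.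
All superpositions of oracles that are used have real amplitudes. -/
theorem posSemidef_map_re {S : Matrix Z Z ℂ} (hS : S.PosSemidef) :
    (S.map Complex.re).PosSemidef := by
  refine .of_dotProduct_mulVec_nonneg ?_ fun w => ?_
  · ext i j
    simpa using congrArg Complex.re (hS.isHermitian.apply i j)
  · have h := (Complex.le_def.1 (hS.dotProduct_mulVec_nonneg fun i => (w i : ℂ))).1
    simpa [dotProduct, mulVec] using h

end Angle

/-! ### Joint states of the unknown oracle and the algorithm -/

section Joint

variable {X Y Z I : Type*}

/-- The block `σ^{ξξ'}` of an operator on `XZ`: the operator `⟨ξ|σ|ξ'⟩` on `X`. -/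
def block (σ : Matrix (X × Z) (X × Z) ℂ) (ξ ξ' : Z) : Matrix X X ℂ :=
  of fun i j => σ (i, ξ) (j, ξ')

theorem block_ampliate (Φ : Matrix X X ℂ →ₗ[ℂ] Matrix Y Y ℂ) (σ : Matrix (X × Z) (X × Z) ℂ)
    (ξ ξ' : Z) : block (ampliate Z Φ σ) ξ ξ' = Φ (block σ ξ ξ') := rfl

variable [Fintype X] [Fintype Y]

/-- The operator `Tr_X ((M ⊗ I) σ)` on `Z`, with entries `Tr (M σ^{ξξ'})`: up to normalization, the
state of `Z` after a measurement of `X` has given the outcome of the measurement operator `M`. -/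
def conditional (M : Matrix X X ℂ) (σ : Matrix (X × Z) (X × Z) ℂ) : Matrix Z Z ℂ :=
  of fun ξ ξ' => (M * block σ ξ ξ').trace

theorem conditional_one_ampliate [DecidableEq X] [DecidableEq Y] (Φ : Channel X Y)
    (σ : Matrix (X × Z) (X × Z) ℂ) :
    conditional 1 (ampliate Z Φ.toLin σ) = conditional 1 σ := by
  ext ξ ξ'
  simp only [conditional, of_apply, Matrix.one_mul, block_ampliate, Φ.tracePreserving]

theorem sum_conditional [DecidableEq X] [Fintype I] (P : POVM X I) (σ : Matrix (X × Z) (X × Z) ℂ) :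
    ∑ i, conditional (P.op i) σ = conditional 1 σ := by
  ext ξ ξ'
  simp only [Matrix.sum_apply, conditional, of_apply]
  rw [← trace_sum, ← Finset.sum_mul, P.sum_eq_one]

variable [Fintype Z]

/-- With `M = C† C`, the operator `Tr_X ((M ⊗ I) σ)` is the partial trace of
`(C ⊗ I) σ (C ⊗ I)†`, a sum of principal submatrices of it. -/
theorem conditional_posSemidef {M : Matrix X X ℂ} (hM : M.PosSemidef)
    {σ : Matrix (X × Z) (X × Z) ℂ} (hσ : σ.PosSemidef) : (conditional M σ).PosSemidef := by
  classical
  open scoped MatrixOrder in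
  obtain ⟨C, rfl⟩ := CStarAlgebra.nonneg_iff_eq_star_mul_self.mp hM.nonneg
  have h : conditional (star C * C) σ
      = ∑ j, (ampliate Z (conjLin C) σ).submatrix (fun ξ => (j, ξ)) (fun ξ => (j, ξ)) := by
    ext ξ ξ'
    rw [Matrix.sum_apply, conditional, of_apply, star_eq_conjTranspose, Matrix.mul_assoc,
      trace_mul_comm]
    rfl
  rw [h]
  refine posSemidef_sum _ fun j _ => PosSemidef.submatrix ?_ _
  rw [ampliate_conjLin]
  exact hσ.mul_mul_conjTranspose_same _

/-- Complete positivity, which is tested on the systems `Fin d`, carries over to every finite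
system `Z`. -/
theorem Channel.posSemidef_ampliate (Φ : Channel X Y) {σ : Matrix (X × Z) (X × Z) ℂ}
    (hσ : σ.PosSemidef) : (ampliate Z Φ.toLin σ).PosSemidef := by
  have e := Fintype.equivFin Z
  have h := (Φ.completelyPositive _ _ (hσ.submatrix (Prod.map id e.symm))).submatrix
    (Prod.map id e)
  convert h using 1
  ext p q
  simp [ampliate]

end Joint

/-! ### Overlaps of the oracle states -/

section Overlap

/-- The sign with which the oracle `ξ` acts on the basis state `a`. -/
def oracleSign {H : Type*} [DecidableEq H] (ξ : Finset H) (a : H) : ℝ := if a ∈ ξ then -1 else 1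

theorem oracleSign_mul_self {H : Type*} [DecidableEq H] (ξ : Finset H) (a : H) :
    oracleSign ξ a * oracleSign ξ a = 1 := by
  unfold oracleSign; split_ifs <;> norm_num

variable {H : Type*} [Fintype H] {k : ℕ}

variable (H k) in
/-- The angle `arcsin √(k/N)` between the uniform superposition of all elements and that of the
unmarked ones. -/
noncomputable def groverAngle : ℝ := Real.arcsin √((k : ℝ) / Fintype.card H)

theorem groverAngle_nonneg : 0 ≤ groverAngle H k := Real.arcsin_nonneg.2 (Real.sqrt_nonneg _)

theorem sin_groverAngle (hk : k ≤ Fintype.card H) :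
    Real.sin (groverAngle H k) = √(k / Fintype.card H) :=
  Real.sin_arcsin (by linarith [Real.sqrt_nonneg ((k : ℝ) / Fintype.card H)])
    (Real.sqrt_le_one.2 (div_le_one_of_le₀ (by exact_mod_cast hk) (by positivity)))

theorem cos_groverAngle (hk_pos : 1 ≤ k) (hk : k ≤ Fintype.card H) :
    Real.cos (groverAngle H k) = √((Fintype.card H - k) / Fintype.card H) := by
  have hN : (Fintype.card H : ℝ) ≠ 0 := by
    have : 0 < Fintype.card H := by omega
    positivity
  rw [groverAngle, Real.cos_arcsin, Real.sq_sqrt (by positivity), sub_div, div_self hN]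

/-- If all elements are marked, that is, if the angle is `π/2`, then the bound is zero, because the
condition on the angle leaves only `n = 0`. -/
theorem cos_mul_groverAngle_eq_zero {n : ℕ} (hn : (2 * n + 1) * groverAngle H k ≤ Real.pi / 2)
    (hcos : Real.cos (groverAngle H k) = 0) : Real.cos ((2 * n + 1) * groverAngle H k) = 0 := by
  have hθ : groverAngle H k = Real.pi / 2 := by
    refine le_antisymm (Real.arcsin_le_pi_div_two _) (not_lt.1 fun h => ?_)
    exact (Real.cos_pos_of_mem_Ioo
      ⟨by linarith [Real.pi_pos, groverAngle_nonneg (H := H) (k := k)], h⟩).ne' hcos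
  have h : (2 * (n : ℝ) + 1) * groverAngle H k = Real.pi / 2 :=
    le_antisymm hn (by rw [hθ]; nlinarith [Real.pi_pos, n.cast_nonneg (α := ℝ)])
  rw [h, Real.cos_pi_div_two]

variable (H k) in
/-- The amplitudes `|Ξ|^{-1/2}` of the uniform superposition of all oracles. -/
noncomputable def oracleAmplitude : {ξ : Finset H // ξ.card = k} → ℝ :=
  fun _ => 1 / √(Fintype.card {ξ : Finset H // ξ.card = k})

theorem card_oracle_pos (hk : k ≤ Fintype.card H) :
    (0 : ℝ) < Fintype.card {ξ : Finset H // ξ.card = k} := by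
  rw [Fintype.card_finset_len]
  exact_mod_cast Nat.choose_pos hk

theorem oracleAmplitude_mul_self (ξ ξ' : {ξ : Finset H // ξ.card = k}) :
    oracleAmplitude H k ξ * oracleAmplitude H k ξ'
      = 1 / Fintype.card {ξ : Finset H // ξ.card = k} := by
  simp only [oracleAmplitude]
  rw [div_mul_div_comm, one_mul, Real.mul_self_sqrt (by positivity)]

theorem sum_oracleAmplitude_mul_self (hk : k ≤ Fintype.card H) :
    oracleAmplitude H k ⬝ᵥ oracleAmplitude H k = 1 := by
  simp only [dotProduct, oracleAmplitude_mul_self]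
  rw [Finset.sum_const, Finset.card_univ, nsmul_eq_mul,
    mul_one_div_cancel (card_oracle_pos hk).ne']

variable [DecidableEq H]

theorem reflection_eq_diagonal_oracleSign (ξ : Finset H) :
    reflection ξ = diagonal fun a => (oracleSign ξ a : ℂ) := by
  rw [reflection_eq_diagonal]
  congr 1
  ext a
  unfold oracleSign
  split_ifs <;> simp

variable (k) in
/-- The superposition of all oracles after the query of `a`. -/
noncomputable def queriedAmplitude (a : H) : {ξ : Finset H // ξ.card = k} → ℝ :=
  fun ξ => oracleSign ξ.1 a * oracleAmplitude H k ξ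

variable (k) in
/-- The uniform superposition of the oracles for which the answer `η` is wrong. -/
noncomputable def wrongAmplitude (η : H) : {ξ : Finset H // ξ.card = k} → ℝ :=
  fun ξ => if η ∈ ξ.1 then 0 else oracleAmplitude H k ξ / Real.cos (groverAngle H k)

theorem card_notMem (η : H) :
    Fintype.card {ξ : {ξ : Finset H // ξ.card = k} // η ∉ ξ.1} = (Fintype.card H - 1).choose k := by
  rw [← Finset.card_univ (α := H), ← Finset.card_erase_of_mem (Finset.mem_univ η),
    ← Finset.card_powersetCard, ← Fintype.card_coe]
  refine Fintype.card_congr ((Equiv.subtypeSubtypeEquivSubtypeInter (fun ξ : Finset H => ξ.card = k)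
    (fun ξ => η ∉ ξ)).trans (Equiv.subtypeEquivRight fun ξ => ?_))
  rw [Finset.mem_powersetCard, Finset.subset_erase]
  simp [and_comm]

/-- By symmetry, the proportion of oracles for which the answer `η` is wrong is `1 - k/N`. -/
theorem card_filter_notMem (hk_pos : 1 ≤ k) (hk : k ≤ Fintype.card H) (η : H) :
    ((Finset.univ.filter fun ξ : {ξ : Finset H // ξ.card = k} => η ∉ ξ.1).card : ℝ)
      = Fintype.card {ξ : Finset H // ξ.card = k} * Real.cos (groverAngle H k) ^ 2 := by
  obtain ⟨m, hm⟩ : ∃ m, Fintype.card H = m + 1 := ⟨Fintype.card H - 1, by omega⟩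
  have h := Nat.choose_mul_succ_eq m k
  have h' : (m.choose k : ℝ) * (m + 1) = (m + 1).choose k * (m + 1 - k) := by
    rw [hm] at hk
    have := congrArg (Nat.cast : ℕ → ℝ) h
    rw [Nat.cast_mul, Nat.cast_mul, Nat.cast_sub hk] at this
    exact_mod_cast this
  have hkN : (k : ℝ) ≤ m + 1 := by rw [hm] at hk; exact_mod_cast hk
  rw [← Fintype.card_subtype, card_notMem, Fintype.card_finset_len, cos_groverAngle hk_pos hk, hm,
    Real.sq_sqrt (by push_cast; apply div_nonneg <;> linarith)]
  push_cast
  rw [mul_div_assoc', ← h']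
  field_simp

theorem queriedAmplitude_dotProduct_self (hk : k ≤ Fintype.card H) (a : H) :
    queriedAmplitude k a ⬝ᵥ queriedAmplitude k a = 1 := by
  rw [← sum_oracleAmplitude_mul_self hk]
  refine Finset.sum_congr rfl fun ξ _ => ?_
  rw [queriedAmplitude, mul_mul_mul_comm, oracleSign_mul_self, one_mul]

/-- The overlap is `1 - 2k/N`, whatever the queried element. -/
theorem oracleAmplitude_dotProduct_queriedAmplitude (hk_pos : 1 ≤ k) (hk : k ≤ Fintype.card H)
    (a : H) :
    oracleAmplitude H k ⬝ᵥ queriedAmplitude k a = Real.cos (2 * groverAngle H k) := by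
  have hc := card_oracle_pos hk
  have h : ∀ ξ : {ξ : Finset H // ξ.card = k}, oracleSign ξ.1 a
      = 2 * (if a ∉ ξ.1 then 1 else 0) - 1 := fun ξ => by
    unfold oracleSign; split_ifs <;> norm_num
  simp only [dotProduct, queriedAmplitude, mul_left_comm, oracleAmplitude_mul_self, h]
  rw [← Finset.sum_mul, Finset.sum_sub_distrib, ← Finset.mul_sum, Finset.sum_boole,
    card_filter_notMem hk_pos hk, Real.cos_two_mul]
  simp only [Finset.sum_const, Finset.card_univ, nsmul_eq_mul, mul_one]
  field_simp

theorem wrongAmplitude_dotProduct_self (hk_pos : 1 ≤ k) (hk : k ≤ Fintype.card H)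
    (hcos : Real.cos (groverAngle H k) ≠ 0) (η : H) :
    wrongAmplitude k η ⬝ᵥ wrongAmplitude k η = 1 := by
  have hc := card_oracle_pos hk
  have h : ∀ ξ : {ξ : Finset H // ξ.card = k}, wrongAmplitude k η ξ * wrongAmplitude k η ξ
      = (if η ∉ ξ.1 then 1 else 0) *
        (1 / Fintype.card {ξ : Finset H // ξ.card = k} / Real.cos (groverAngle H k) ^ 2) :=
    fun ξ => by
      unfold wrongAmplitude
      split_ifs
      · simp
      · rw [div_mul_div_comm, oracleAmplitude_mul_self, one_mul, pow_two]
  simp only [dotProduct, h]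
  rw [← Finset.sum_mul, Finset.sum_boole, card_filter_notMem hk_pos hk]
  field_simp

theorem oracleAmplitude_dotProduct_wrongAmplitude (hk_pos : 1 ≤ k) (hk : k ≤ Fintype.card H)
    (hcos : Real.cos (groverAngle H k) ≠ 0) (η : H) :
    oracleAmplitude H k ⬝ᵥ wrongAmplitude k η = Real.cos (groverAngle H k) := by
  have hc := card_oracle_pos hk
  have h : ∀ ξ : {ξ : Finset H // ξ.card = k}, oracleAmplitude H k ξ * wrongAmplitude k η ξ
      = (if η ∉ ξ.1 then 1 else 0) *
        (1 / Fintype.card {ξ : Finset H // ξ.card = k} / Real.cos (groverAngle H k)) :=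
    fun ξ => by
      unfold wrongAmplitude
      split_ifs
      · simp
      · rw [mul_div_assoc', oracleAmplitude_mul_self, one_mul]
  simp only [dotProduct, h]
  rw [← Finset.sum_mul, Finset.sum_boole, card_filter_notMem hk_pos hk]
  field_simp

end Overlap

/-! ### The lower bound -/

section LowerBound

variable {H R : Type*} [Fintype H] [DecidableEq H] [Fintype R] [DecidableEq R] {k : ℕ}

variable (k R) in
/-- The query `∑_ξ O^ξ ⊗ |ξ⟩⟨ξ|` controlled by the unknown oracle. -/
def controlledQuery : Matrix ((H × R) × {ξ : Finset H // ξ.card = k})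
    ((H × R) × {ξ : Finset H // ξ.card = k}) ℂ :=
  diagonal fun p => (oracleSign p.2.1 p.1.1 : ℂ)

theorem controlledQuery_conj_apply (τ : Matrix ((H × R) × {ξ : Finset H // ξ.card = k})
    ((H × R) × {ξ : Finset H // ξ.card = k}) ℂ)
    (p q : (H × R) × {ξ : Finset H // ξ.card = k}) :
    (controlledQuery R k * τ * (controlledQuery R k)ᴴ : Matrix _ _ ℂ) p q
      = oracleSign p.2.1 p.1.1 * τ p q * oracleSign q.2.1 q.1.1 := by
  simp [controlledQuery, diagonal_conjTranspose, diagonal_mul, mul_diagonal]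

/-- Conditioned on the oracle `ξ`, the controlled query is the query to `ξ`. -/
theorem block_controlledQuery (τ : Matrix ((H × R) × {ξ : Finset H // ξ.card = k})
    ((H × R) × {ξ : Finset H // ξ.card = k}) ℂ) (ξ : {ξ : Finset H // ξ.card = k}) :
    block (controlledQuery R k * τ * (controlledQuery R k)ᴴ) ξ ξ
      = ampliate R (conjLin (reflection ξ.1)) (block τ ξ ξ) := by
  ext p q
  rw [block, of_apply, controlledQuery_conj_apply]
  simp [ampliate, conjLin, reflection_eq_diagonal_oracleSign, diagonal_conjTranspose,
    diagonal_mul, mul_diagonal, block]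

/-- The weight of the uniform superposition of all oracles in the joint state `σ`. -/
noncomputable def uniformWeight (σ : Matrix ((H × R) × {ξ : Finset H // ξ.card = k})
    ((H × R) × {ξ : Finset H // ξ.card = k}) ℂ) : ℝ :=
  oracleAmplitude H k ⬝ᵥ (conditional 1 σ).map Complex.re *ᵥ oracleAmplitude H k

variable (H R) in
/-- The measurement of `H` in the computational basis. -/
noncomputable abbrev basisMeasurement : POVM (H × R) H := measureAfter R 1 (by simp)

theorem conditional_basisMeasurement (a : H)
    (τ : Matrix ((H × R) × {ξ : Finset H // ξ.card = k})
    ((H × R) × {ξ : Finset H // ξ.card = k}) ℂ) (ξ ξ') :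
    conditional ((basisMeasurement H R).op a) τ ξ ξ' = ∑ r, τ ((a, r), ξ) ((a, r), ξ') := by
  simp [conditional, measureAfter, block, trace, mul_apply, Fintype.sum_prod_type, one_apply,
    single_apply, ite_and]

/-- As the controlled query is diagonal, the weight after it can be computed as if the queried
element `a` had been measured: it is the total weight of the superpositions `queriedAmplitude k a`
before the query. -/
theorem uniformWeight_controlledQuery (τ : Matrix ((H × R) × {ξ : Finset H // ξ.card = k})
    ((H × R) × {ξ : Finset H // ξ.card = k}) ℂ) :
    uniformWeight (controlledQuery R k * τ * (controlledQuery R k)ᴴ)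
      = ∑ a, queriedAmplitude k a ⬝ᵥ
          (conditional ((basisMeasurement H R).op a) τ).map Complex.re *ᵥ queriedAmplitude k a := by
  have h : ∀ ξ ξ', (conditional 1 (controlledQuery R k * τ * (controlledQuery R k)ᴴ) ξ ξ').re
      = ∑ a, oracleSign ξ.1 a * oracleSign ξ'.1 a *
          (conditional ((basisMeasurement H R).op a) τ ξ ξ').re := fun ξ ξ' => by
    simp only [conditional_basisMeasurement]
    simp only [conditional, of_apply, Matrix.one_mul, trace, diag_apply, block,
      controlledQuery_conj_apply, Fintype.sum_prod_type, Complex.re_sum, Complex.re_mul_ofReal,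
      Complex.re_ofReal_mul, Finset.mul_sum]
    exact Finset.sum_congr rfl fun _ _ => Finset.sum_congr rfl fun _ _ => by ring
  simp only [uniformWeight, dotProduct, mulVec, map_apply, h, queriedAmplitude, Finset.mul_sum,
    Finset.sum_mul]
  rw [Finset.sum_comm_cycle]
  exact Finset.sum_congr rfl fun _ _ => Finset.sum_congr rfl fun _ _ =>
    Finset.sum_congr rfl fun _ _ => by ring

theorem sum_map_re_conditional {X Z I : Type*} [Fintype X] [DecidableEq X] [Fintype Z] [Fintype I]
    (P : POVM X I) (σ : Matrix (X × Z) (X × Z) ℂ) :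
    ∑ i, (conditional (P.op i) σ).map Complex.re = (conditional 1 σ).map Complex.re := by
  rw [← sum_conditional P]
  ext ξ ξ'
  simp [Matrix.sum_apply]

theorem sum_dotProduct_conditional {X Z I : Type*} [Fintype X] [DecidableEq X] [Fintype Z]
    [Fintype I] (P : POVM X I) (σ : Matrix (X × Z) (X × Z) ℂ) (u : Z → ℝ) :
    ∑ i, u ⬝ᵥ (conditional (P.op i) σ).map Complex.re *ᵥ u
      = u ⬝ᵥ (conditional 1 σ).map Complex.re *ᵥ u := by
  rw [← sum_map_re_conditional P, sum_mulVec, dotProduct_sum]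

theorem sum_trace_conditional {X Z I : Type*} [Fintype X] [DecidableEq X] [Fintype Z]
    [Fintype I] (P : POVM X I) (σ : Matrix (X × Z) (X × Z) ℂ) :
    ∑ i, ((conditional (P.op i) σ).map Complex.re).trace
      = ((conditional 1 σ).map Complex.re).trace := by
  rw [← sum_map_re_conditional P, trace_sum]

/-- The joint state reached after `n` queries when the oracle is prepared in uniform superposition:
conditioned on the oracle `ξ` the algorithm is in its state for `ξ`, and each query has moved the
oracle system away from the uniform superposition by an angle of at most `2 arcsin √(k/N)`. -/
theorem exists_jointState (hk_pos : 1 ≤ k) (hk : k ≤ Fintype.card H) (z : H × R) (n : ℕ)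
    (hn : n * (2 * groverAngle H k) ≤ Real.pi / 2) (step : Fin n → Channel (H × R) (H × R)) :
    ∃ σ : Matrix ((H × R) × {ξ : Finset H // ξ.card = k})
        ((H × R) × {ξ : Finset H // ξ.card = k}) ℂ,
      σ.PosSemidef ∧ ((conditional 1 σ).map Complex.re).trace = 1 ∧
      (∀ ξ, block σ ξ ξ = ((1 / Fintype.card {ξ : Finset H // ξ.card = k} : ℝ) : ℂ) •
        Fin.foldl n (fun ρ j => ampliate R (conjLin (reflection ξ.1)) ((step j).toLin ρ))
          (single z z 1)) ∧
      Real.cos (n * (2 * groverAngle H k)) ^ 2 ≤ uniformWeight σ := by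
  have hθ := groverAngle_nonneg (H := H) (k := k)
  induction n with
  | zero =>
    let ψ : (H × R) × {ξ : Finset H // ξ.card = k} → ℂ :=
      fun p => if p.1 = z then (oracleAmplitude H k p.2 : ℂ) else 0
    have hψ : ∀ ξ ξ', block (vecMulVec ψ (star ψ)) ξ ξ'
        = ((1 / Fintype.card {ξ : Finset H // ξ.card = k} : ℝ) : ℂ) • single z z 1 := by
      intro ξ ξ'
      rw [← oracleAmplitude_mul_self ξ ξ']
      ext p q
      simp only [block, of_apply, vecMulVec_apply, ψ, Pi.star_apply, Matrix.smul_apply,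
        single_apply, smul_eq_mul]
      by_cases hp : p = z <;> by_cases hq : q = z <;> simp [hp, hq, Ne.symm]
    have hc : ∀ ξ ξ', (conditional 1 (vecMulVec ψ (star ψ)) ξ ξ').re
        = oracleAmplitude H k ξ * oracleAmplitude H k ξ' := by
      intro ξ ξ'
      rw [conditional, of_apply, Matrix.one_mul, hψ, oracleAmplitude_mul_self]
      simp
    refine ⟨_, posSemidef_vecMulVec_self_star ψ, ?_, fun ξ => by simpa using hψ ξ ξ, ?_⟩
    · simp only [trace, diag_apply, map_apply, hc]
      exact sum_oracleAmplitude_mul_self hk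
    · have h1 := sum_oracleAmplitude_mul_self hk
      have hm : (conditional 1 (vecMulVec ψ (star ψ))).map Complex.re
          = vecMulVec (oracleAmplitude H k) (oracleAmplitude H k) := by
        ext ξ ξ'
        rw [map_apply, hc, vecMulVec_apply]
      rw [uniformWeight, hm, vecMulVec_mulVec, h1]
      simp [h1]
  | succ n ih =>
    rw [Nat.cast_succ] at hn ⊢
    obtain ⟨σ, hσ, htr, hblock, hw⟩ := ih (by linarith) fun j => step j.castSucc
    set τ := ampliate {ξ : Finset H // ξ.card = k} (step (Fin.last n)).toLin σ with hτdef
    have hτ : τ.PosSemidef := (step (Fin.last n)).posSemidef_ampliate hσ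
    have hτ1 : conditional 1 τ = conditional 1 σ := conditional_one_ampliate _ σ
    refine ⟨controlledQuery R k * τ * (controlledQuery R k)ᴴ, hτ.mul_mul_conjTranspose_same _,
      ?_, fun ξ => ?_, ?_⟩
    · rw [← htr, ← hτ1]
      simp only [trace, diag_apply, map_apply, conditional, of_apply, Matrix.one_mul, block,
        controlledQuery_conj_apply]
      refine Finset.sum_congr rfl fun ξ _ => congrArg _ (Finset.sum_congr rfl fun p _ => ?_)
      rw [mul_right_comm, ← Complex.ofReal_mul, oracleSign_mul_self, Complex.ofReal_one, one_mul]
    · rw [block_controlledQuery, hτdef, block_ampliate, hblock, map_smul, map_smul,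
        Fin.foldl_succ_last]
    · rw [uniformWeight_controlledQuery, add_mul, one_mul]
      refine cos_sq_add_le_sum_posSemidef (u := oracleAmplitude H k)
        (fun a => posSemidef_map_re (conditional_posSemidef (POVM.posSemidef _ a) hτ)) ?_
        (by positivity) (by positivity) (by linarith) (sum_oracleAmplitude_mul_self hk)
        (queriedAmplitude_dotProduct_self hk)
        (oracleAmplitude_dotProduct_queriedAmplitude hk_pos hk) ?_
      · rw [sum_trace_conditional, hτ1, htr]
      · rw [sum_dotProduct_conditional, hτ1]
        exact hw

/-- The error probability in terms of the joint state: the factor `1/|Ξ|` of its diagonal blocks is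
the prior. -/
theorem errorProb_eq_sum {n : ℕ} (hk : k ≤ Fintype.card H) (z : H × R)
    (alg : DiscriminationAlgorithm H H R H n)
    {σ : Matrix ((H × R) × {ξ : Finset H // ξ.card = k})
        ((H × R) × {ξ : Finset H // ξ.card = k}) ℂ}
    (hσ : ∀ ξ, block σ ξ ξ = ((1 / Fintype.card {ξ : Finset H // ξ.card = k} : ℝ) : ℂ) •
        Fin.foldl n (fun ρ j => ampliate R (conjLin (reflection ξ.1)) ((alg.step j).toLin ρ))
          (single z z 1)) :
    alg.errorProb (searchProblem H k hk) z
      = ∑ η, ∑ ξ : {ξ : Finset H // ξ.card = k} with η ∉ ξ.1,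
          (conditional (alg.measurement.op η) σ).map Complex.re ξ ξ := by
  classical
  simp only [DiscriminationAlgorithm.errorProb, Finset.sum_filter, Finset.mul_sum]
  rw [Finset.sum_comm]
  refine Finset.sum_congr rfl fun η _ => Finset.sum_congr rfl fun ξ _ => ?_
  rw [mul_ite, mul_zero, map_apply, conditional, of_apply, hσ, mul_smul_comm, trace_smul,
    smul_eq_mul, Complex.re_ofReal_mul]
  exact if_congr Iff.rfl rfl rfl

/-- The lower bound: the final measurement adds one more angle `arcsin √(k/N)` to those of the
queries. -/
theorem cos_sq_le_errorProb (hk_pos : 1 ≤ k) (hk : k ≤ Fintype.card H) (z : H × R) {n : ℕ}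
    (hn : (2 * n + 1) * groverAngle H k ≤ Real.pi / 2)
    (alg : DiscriminationAlgorithm H H R H n) :
    Real.cos ((2 * n + 1) * groverAngle H k) ^ 2 ≤ alg.errorProb (searchProblem H k hk) z := by
  have hθ := groverAngle_nonneg (H := H) (k := k)
  obtain ⟨σ, hσ, htr, hblock, hw⟩ :=
    exists_jointState hk_pos hk z n (by linarith) alg.step
  rw [errorProb_eq_sum hk z alg hblock]
  have hA := fun η => posSemidef_map_re
    (conditional_posSemidef (alg.measurement.posSemidef η) hσ)
  by_cases hcos : Real.cos (groverAngle H k) = 0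
  · rw [cos_mul_groverAngle_eq_zero hn hcos, zero_pow two_ne_zero]
    exact Finset.sum_nonneg fun η _ => Finset.sum_nonneg fun ξ _ => (hA η).diag_nonneg
  calc Real.cos ((2 * n + 1) * groverAngle H k) ^ 2
      = Real.cos (n * (2 * groverAngle H k) + groverAngle H k) ^ 2 := by ring_nf
    _ ≤ ∑ η, wrongAmplitude k η ⬝ᵥ
          (conditional (alg.measurement.op η) σ).map Complex.re *ᵥ wrongAmplitude k η := by
        refine cos_sq_add_le_sum_posSemidef (u := oracleAmplitude H k) hA ?_
          (by positivity) hθ (by linarith) (sum_oracleAmplitude_mul_self hk)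
          (wrongAmplitude_dotProduct_self hk_pos hk hcos)
          (oracleAmplitude_dotProduct_wrongAmplitude hk_pos hk hcos) ?_
        · rw [sum_trace_conditional, htr]
        · rw [sum_dotProduct_conditional]
          exact hw
    _ ≤ _ := Finset.sum_le_sum fun η _ => dotProduct_mulVec_le_sum_diag (hA η)
        (wrongAmplitude_dotProduct_self hk_pos hk hcos η) _ fun ξ hξ => by
          simp only [Finset.mem_filter_univ, not_not] at hξ
          simp [wrongAmplitude, hξ]

end LowerBound

/-! ### The error probability of Grover's algorithm -/

section Attained

theorem conj_kronecker_pure {H R : Type*} [Fintype H] [Fintype R] [DecidableEq R]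
    (V : Matrix H H ℂ) (w : H → ℂ) (B : Matrix R R ℂ) :
    (V ⊗ₖ (1 : Matrix R R ℂ)) * (vecMulVec w (star w) ⊗ₖ B) * (V ⊗ₖ (1 : Matrix R R ℂ))ᴴ
      = vecMulVec (V *ᵥ w) (star (V *ᵥ w)) ⊗ₖ B := by
  rw [conjTranspose_kronecker, ← mul_kronecker_mul, ← mul_kronecker_mul, conjTranspose_one,
    Matrix.mul_one, Matrix.one_mul, mul_vecMulVec, vecMulVec_mul, star_mulVec]

variable {H R : Type*} [Fintype H] [DecidableEq H] [Fintype R] [DecidableEq R] {k : ℕ}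

/-- The state vector of `H` right after query number `n` to the oracle `ξ` in Grover's algorithm,
started in the basis state `a`. -/
noncomputable def groverVector (F : unitaryGroup H ℂ) (ξ : Finset H) (a : H) : ℕ → H → ℂ
  | 0 => Pi.single a 1
  | n + 1 => reflection ξ *ᵥ (groverGate F n *ᵥ groverVector F ξ a n)

variable (k) in
/-- The unit vector at the angle `x` from the uniform superposition of the unmarked elements, in the
plane that it spans with the uniform superposition of the marked elements. Here `k` stands for the
cardinality of `ξ`. If all elements are marked, the second case of the definition is empty, and the
vector is only `sin x` times a unit vector. -/
noncomputable def groverPlane (ξ : Finset H) (x : ℝ) : H → ℂ :=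
  fun η => ((if η ∈ ξ then Real.sin x / √k else Real.cos x / √(Fintype.card H - k) : ℝ) : ℂ)

theorem groverPlane_groverAngle (hk_pos : 1 ≤ k) (hk : k ≤ Fintype.card H) {ξ : Finset H}
    (hξ : ξ.card = k) : groverPlane k ξ (groverAngle H k) = uniformState H := by
  have hN : (0 : ℝ) < Fintype.card H := by exact_mod_cast hk_pos.trans hk
  have hk0 : (0 : ℝ) < k := by exact_mod_cast hk_pos
  ext η
  rw [groverPlane, uniformState]
  congr 1
  split_ifs with hη
  · rw [sin_groverAngle hk, Real.sqrt_div hk0.le]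
    have := (Real.sqrt_pos.2 hk0).ne'
    field_simp
  · have hlt : (k : ℝ) < Fintype.card H := by
      rw [← hξ]
      exact_mod_cast Finset.card_lt_univ_of_notMem hη
    have hlt' : (0 : ℝ) < Fintype.card H - k := sub_pos.2 hlt
    rw [cos_groverAngle hk_pos hk, Real.sqrt_div hlt'.le]
    have := (Real.sqrt_pos.2 hlt').ne'
    field_simp

theorem sum_reflection_groverPlane (hk : k ≤ Fintype.card H) {ξ : Finset H} (hξ : ξ.card = k)
    (x : ℝ) : ∑ η, (reflection ξ *ᵥ groverPlane k ξ x) η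
      = ((√(Fintype.card H - k) * Real.cos x - √k * Real.sin x : ℝ) : ℂ) := by
  have h : ∀ η, (reflection ξ *ᵥ groverPlane k ξ x) η = ((if η ∈ ξ then -(Real.sin x / √k)
      else Real.cos x / √(Fintype.card H - k) : ℝ) : ℂ) := fun η => by
    rw [reflection_eq_diagonal_oracleSign, mulVec_diagonal, groverPlane, oracleSign]
    split_ifs <;> simp
  simp only [h]
  rw [← Complex.ofReal_sum, Finset.sum_ite, Finset.sum_const, Finset.sum_const,
    Finset.filter_mem_eq_inter, Finset.univ_inter, Finset.filter_notMem_eq_sdiff,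
    Finset.card_univ_sdiff, hξ, nsmul_eq_mul, nsmul_eq_mul, Nat.cast_sub hk]
  congr 1
  -- `x / √x = √x` also holds for `x = 0`, the case in which all elements are marked.
  have h1 := Real.div_sqrt (x := (Fintype.card H : ℝ) - k)
  have h2 := Real.div_sqrt (x := (k : ℝ))
  linear_combination Real.cos x * h1 - Real.sin x * h2

/-- A query followed by the diffusion operator rotates the plane by `2 arcsin √(k/N)`. -/
theorem diffusion_reflection_groverPlane (hk_pos : 1 ≤ k) (hk : k ≤ Fintype.card H) {ξ : Finset H}
    (hξ : ξ.card = k) (x : ℝ) :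
    diffusion H *ᵥ (reflection ξ *ᵥ groverPlane k ξ x)
      = groverPlane k ξ (x + 2 * groverAngle H k) := by
  have hN : (0 : ℝ) < Fintype.card H := by exact_mod_cast hk_pos.trans hk
  have hk0 : (0 : ℝ) < k := by exact_mod_cast hk_pos
  have hle : (0 : ℝ) ≤ Fintype.card H - k := sub_nonneg.2 (by exact_mod_cast hk)
  set θ := groverAngle H k with hθ
  have hs : √(k : ℝ) = √(Fintype.card H) * Real.sin θ := by
    rw [sin_groverAngle hk, Real.sqrt_div hk0.le, mul_div_cancel₀]
    exact (Real.sqrt_pos.2 hN).ne'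
  have hc : √((Fintype.card H : ℝ) - k) = √(Fintype.card H) * Real.cos θ := by
    rw [cos_groverAngle hk_pos hk, Real.sqrt_div hle, mul_div_cancel₀]
    exact (Real.sqrt_pos.2 hN).ne'
  -- The overlap with the uniform superposition is `cos (x + θ)`.
  have hov : star (uniformState H) ⬝ᵥ (reflection ξ *ᵥ groverPlane k ξ x)
      = (Real.cos (x + θ) : ℂ) := by
    have h : ∀ w : H → ℂ, star (uniformState H) ⬝ᵥ w
        = ((1 / √(Fintype.card H : ℝ) : ℝ) : ℂ) * ∑ η, w η := fun w => by
      simp [dotProduct, uniformState, Finset.mul_sum]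
    rw [h, sum_reflection_groverPlane hk hξ, ← Complex.ofReal_mul, hs, hc, Real.cos_add]
    congr 1
    have := (Real.sqrt_pos.2 hN).ne'
    field_simp
  rw [diffusion, sub_mulVec, smul_mulVec, vecMulVec_mulVec, hov, one_mulVec,
    ← groverPlane_groverAngle hk_pos hk hξ, ← hθ, reflection_eq_diagonal_oracleSign]
  ext η
  simp only [Pi.sub_apply, Pi.smul_apply, mulVec_diagonal, groverPlane, oracleSign, smul_eq_mul,
    MulOpposite.smul_eq_mul_unop, MulOpposite.unop_op]
  rw [← Complex.ofReal_ofNat, ← Complex.ofReal_mul, ← Complex.ofReal_mul, ← Complex.ofReal_mul,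
    ← Complex.ofReal_sub]
  congr 1
  have e1 : Real.sin (x + 2 * θ) = 2 * Real.sin θ * Real.cos (x + θ) + Real.sin x := by
    have h1 := Real.sin_add (x + θ) θ
    have h2 := Real.sin_sub (x + θ) θ
    rw [add_sub_cancel_right] at h2
    rw [show x + 2 * θ = x + θ + θ by ring]
    linear_combination h1 - h2
  have e2 : Real.cos (x + 2 * θ) = 2 * Real.cos θ * Real.cos (x + θ) - Real.cos x := by
    have h1 := Real.cos_add (x + θ) θ
    have h2 := Real.cos_sub (x + θ) θ
    rw [add_sub_cancel_right] at h2
    rw [show x + 2 * θ = x + θ + θ by ring]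
    linear_combination h1 + h2
  split_ifs
  · rw [e1]; ring
  · rw [e2]; ring

theorem groverGate_mulVec_groverVector (hk_pos : 1 ≤ k) (hk : k ≤ Fintype.card H) {ξ : Finset H}
    (hξ : ξ.card = k) {F : unitaryGroup H ℂ} {a : H}
    (hF : F.1 *ᵥ Pi.single a 1 = uniformState H) (n : ℕ) :
    groverGate F n *ᵥ groverVector F ξ a n
      = groverPlane k ξ ((2 * n + 1) * groverAngle H k) := by
  induction n with
  | zero =>
    rw [groverGate, groverVector, hF, Nat.cast_zero, mul_zero, zero_add, one_mul,
      groverPlane_groverAngle hk_pos hk hξ]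
  | succ n ih =>
    rw [groverGate, groverVector, ih, diffusion_reflection_groverPlane hk_pos hk hξ]
    congr 1
    push_cast
    ring

theorem finalState_groverAlgorithm (hk : k ≤ Fintype.card H) (F : unitaryGroup H ℂ) (z : H × R)
    (n : ℕ) (ξ : {ξ : Finset H // ξ.card = k}) :
    (groverAlgorithm R F n).finalState ((searchProblem H k hk).oracle ξ) z
      = vecMulVec (groverVector F ξ.1 z.1 n) (star (groverVector F ξ.1 z.1 n))
          ⊗ₖ single z.2 z.2 1 := by
  rw [DiscriminationAlgorithm.finalState]
  induction n with
  | zero =>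
    rw [Fin.foldl_zero, groverVector]
    ext p q
    simp only [single_apply, kroneckerMap_apply, vecMulVec_apply, Pi.star_apply, Pi.single_apply,
      apply_ite star, star_one, star_zero]
    grind
  | succ n ih =>
    rw [Fin.foldl_succ_last]
    have h : ∀ ρ : Matrix (H × R) (H × R) ℂ,
        ampliate R ((searchProblem H k hk).oracle ξ).toLin
          (((groverAlgorithm R F (n + 1)).step (Fin.last n)).toLin ρ)
        = (reflection ξ.1 ⊗ₖ (1 : Matrix R R ℂ)) *
          ((groverGate F n ⊗ₖ (1 : Matrix R R ℂ)) * ρ * (groverGate F n ⊗ₖ (1 : Matrix R R ℂ))ᴴ)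
          * (reflection ξ.1 ⊗ₖ (1 : Matrix R R ℂ))ᴴ := fun ρ =>
      ampliate_conjLin (reflection ξ.1) _
    rw [h]
    refine (congrArg (fun ρ => (reflection ξ.1 ⊗ₖ (1 : Matrix R R ℂ)) *
      ((groverGate F n ⊗ₖ (1 : Matrix R R ℂ)) * ρ * (groverGate F n ⊗ₖ (1 : Matrix R R ℂ))ᴴ)
      * (reflection ξ.1 ⊗ₖ (1 : Matrix R R ℂ))ᴴ) ih).trans ?_
    rw [conj_kronecker_pure, conj_kronecker_pure, groverVector]

/-- The Born rule for a measurement of the first factor after the gate `V`. -/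
theorem trace_measureAfter (V : Matrix H H ℂ) (hV : Vᴴ * V = 1) (w : H → ℂ) (r : R) (η : H) :
    ((measureAfter R V hV).op η * (vecMulVec w (star w) ⊗ₖ single r r 1)).trace
      = (V *ᵥ w) η * star ((V *ᵥ w) η) := by
  have h : ((measureAfter R V hV).op η)
      = (Vᴴ * single η η (1 : ℂ) * V) ⊗ₖ (1 : Matrix R R ℂ) := rfl
  rw [h, ← mul_kronecker_mul, trace_kronecker, Matrix.one_mul, trace_single_eq_same, mul_one,
    Matrix.mul_assoc, Matrix.mul_assoc, trace_mul_comm, Matrix.mul_assoc, Matrix.mul_assoc,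
    ← Matrix.mul_assoc V, mul_vecMulVec, vecMulVec_mul, ← star_mulVec, trace_single_mul]
  simp [vecMulVec_apply]

theorem errorProb_groverAlgorithm (hk_pos : 1 ≤ k) (hk : k ≤ Fintype.card H) (z : H × R) {n : ℕ}
    (hn : (2 * n + 1) * groverAngle H k ≤ Real.pi / 2) {F : unitaryGroup H ℂ}
    (hF : F.1 *ᵥ Pi.single z.1 1 = uniformState H) :
    (groverAlgorithm R F n).errorProb (searchProblem H k hk) z
      = Real.cos ((2 * n + 1) * groverAngle H k) ^ 2 := by
  classical
  set x := (2 * (n : ℝ) + 1) * groverAngle H k with hx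
  have hle : (0 : ℝ) ≤ Fintype.card H - k := sub_nonneg.2 (by exact_mod_cast hk)
  have h : ∀ ξ : {ξ : Finset H // ξ.card = k}, ∑ η with η ∉ ξ.1,
      (((groverAlgorithm R F n).measurement.op η *
        (groverAlgorithm R F n).finalState ((searchProblem H k hk).oracle ξ) z).trace).re
      = Real.cos x ^ 2 := by
    intro ξ
    have h1 : ∀ η ∈ Finset.univ.filter (· ∉ ξ.1),
        (((groverAlgorithm R F n).measurement.op η *
        (groverAlgorithm R F n).finalState ((searchProblem H k hk).oracle ξ) z).trace).re
          = Real.cos x ^ 2 / (Fintype.card H - k) := by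
      intro η hη
      rw [Finset.mem_filter_univ] at hη
      rw [finalState_groverAlgorithm]
      refine (congrArg Complex.re (trace_measureAfter _ (groverGate_isometry F n) _ _ _)).trans ?_
      rw [groverGate_mulVec_groverVector hk_pos hk ξ.2 hF, groverPlane, if_neg hη,
        Complex.star_def, Complex.conj_ofReal, ← Complex.ofReal_mul, Complex.ofReal_re,
        div_mul_div_comm, Real.mul_self_sqrt hle, ← pow_two]
    rw [Finset.sum_congr rfl h1, Finset.sum_const, Finset.filter_notMem_eq_sdiff,
      Finset.card_univ_sdiff, ξ.2, nsmul_eq_mul, Nat.cast_sub hk]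
    rcases hle.eq_or_lt with h0 | h0
    · -- If all elements are marked, there are no wrong answers, and the angle is `π/2`.
      have hcos : Real.cos (groverAngle H k) = 0 := by
        rw [cos_groverAngle hk_pos hk, ← h0, zero_div, Real.sqrt_zero]
      rw [← h0, zero_mul, hx, cos_mul_groverAngle_eq_zero hn hcos, zero_pow two_ne_zero]
    · exact mul_div_cancel₀ _ h0.ne'
  have h2 : (groverAlgorithm R F n).errorProb (searchProblem H k hk) z
      = ∑ ξ : {ξ : Finset H // ξ.card = k},
          1 / (Fintype.card {ξ : Finset H // ξ.card = k} : ℝ) * Real.cos x ^ 2 := by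
    refine Finset.sum_congr rfl fun ξ _ => ?_
    rw [← h ξ]
    refine congrArg _ (Finset.sum_congr ?_ fun _ _ => rfl)
    ext η
    simp [searchProblem]
  rw [h2, ← Finset.sum_mul, Finset.sum_const, Finset.card_univ, nsmul_eq_mul,
    mul_one_div_cancel (card_oracle_pos hk).ne', one_mul]

theorem exists_unitary_mulVec_eq_uniformState (a : H) :
    ∃ F : unitaryGroup H ℂ, F.1 *ᵥ Pi.single a 1 = uniformState H := by
  have hN : (0 : ℝ) < Fintype.card H := by exact_mod_cast Fintype.card_pos_iff.2 ⟨a⟩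
  have hs : ‖(WithLp.toLp 2 (uniformState H) : EuclideanSpace ℂ H)‖ = 1 := by
    rw [EuclideanSpace.norm_eq, Real.sqrt_eq_one]
    simp [uniformState, Real.sqrt_nonneg, abs_of_nonneg, hN.ne']
  obtain ⟨b, hb⟩ := Orthonormal.exists_orthonormalBasis_extension_of_card_eq
    (𝕜 := ℂ) (E := EuclideanSpace ℂ H) (ι := H) (by simp)
    (v := fun _ => WithLp.toLp 2 (uniformState H)) (s := {a})
    ⟨fun _ => hs, fun i j hij => (hij (Subsingleton.elim i j)).elim⟩
  refine ⟨⟨_, (EuclideanSpace.basisFun H ℂ).toMatrix_orthonormalBasis_mem_unitary b⟩, ?_⟩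
  ext η
  simp [Module.Basis.toMatrix_apply, hb a rfl]

end Attained

end QChan

theorem mainTheorem2 {H R : Type*} [Fintype H] [DecidableEq H] [Fintype R] [DecidableEq R]
    (k : ℕ) (hk_pos : 1 ≤ k) (hk : k ≤ Fintype.card H) (z : H × R) (n : ℕ)
    (hangle : (2 * (n : ℝ) + 1) * Real.arcsin (√((k : ℝ) / (Fintype.card H : ℝ)))
      ≤ Real.pi / 2) :
    (∀ alg : QChan.DiscriminationAlgorithm H H R H n,
      Real.cos ((2 * (n : ℝ) + 1) * Real.arcsin (√((k : ℝ) / (Fintype.card H : ℝ)))) ^ 2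
        ≤ alg.errorProb (QChan.searchProblem H k hk) z) ∧
    (∀ F : Matrix.unitaryGroup H ℂ,
      F.1 *ᵥ Pi.single z.1 1 = QChan.uniformState H →
      (QChan.groverAlgorithm R F n).errorProb (QChan.searchProblem H k hk) z
        = Real.cos ((2 * (n : ℝ) + 1) * Real.arcsin (√((k : ℝ) / (Fintype.card H : ℝ)))) ^ 2) ∧
    QChan.minErrorProb (QChan.searchProblem H k hk) z n
      = Real.cos ((2 * (n : ℝ) + 1) * Real.arcsin (√((k : ℝ) / (Fintype.card H : ℝ)))) ^ 2 := by
  have hlower := QChan.cos_sq_le_errorProb hk_pos hk z hangle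
  have hgrover := fun F => QChan.errorProb_groverAlgorithm hk_pos hk z hangle (F := F)
  refine ⟨hlower, hgrover, ?_⟩
  obtain ⟨F, hF⟩ := QChan.exists_unitary_mulVec_eq_uniformState z.1
  refine IsLeast.csInf_eq ⟨⟨QChan.groverAlgorithm R F n, hgrover F hF⟩, ?_⟩
  rintro _ ⟨alg, rfl⟩
  exact hlower alg
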